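/- Let $k$ be an algebraically closed field of characteristic zero and let $n \ge 0$. Let $R = k[x_0,x_1,y_0,\dots,y_n]$ be the coordinate ring of $\mathbb{P}^1\times\mathbb{P}^n$ over $k$, bigraded by $\deg x_i = (1,0)$ and $\deg y_j = (0,1)$. For a finite set of points $X \subseteq \mathbb{P}^1\times\mathbb{P}^n$ let $I_X \subseteq R$ be the ideal generated by all bihomogeneous forms that vanish at every point of $X$. The set $X$ is called arithmetically Cohen-Macaulay (ACM) if $R/I_X$ is Cohen-Macaulay of dimension two, that is, if $\dim R/I_X = \operatorname{depth} R/I_X = 2$, where $\dim$ is the Krull dimension and the depth is the supremum of the lengths of the $R/I_X$-regular sequences contained in the homogeneous maximal ideal $(x_0,x_1,y_0,\dots,y_n)$. Theorem. Let $r \ge 1$, and let $\lambda = (\lambda_1,\dots,\lambda_r)$ be a partition of an integer $s$, i.e. a tuple of positive integers with $\lambda_1 \ge \lambda_2 \ge \dots \ge \lambda_r$ and $\sum_i \lambda_i = s$. Let $P_1,\dots,P_r$ be distinct points of $\mathbb{P}^1$ and let $Q_1,\dots,Q_{\lambda_1}$ be distinct points of $\mathbb{P}^n$. Then the set of points $$X_\lambda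 = \{P_i\times Q_j : 1 \le i \le r,\ 1 \le j \le \lambda_i\} \subseteq \mathbb{P}^1\times\mathbb{P}^n$$ is arithmetically Cohen-Macaulay. -/

import Mathlib

open scoped LinearAlgebra.Projectivization

/-- Projective `n`-space over `k`: lines through the origin in `k ^ (n + 1)`. -/
abbrev ProjSpace (k : Type*) [Field k] (n : ℕ) : Type _ := ℙ k (Fin (n + 1) → k)

/-- The bigraded coordinate ring `k[x_0, …, x_m, y_0, …, y_n]` of `ℙ^m × ℙ^n`;
`x_i` is `X (Sum.inl i)` and `y_j` is `X (Sum.inr j)`. -/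
abbrev BiCoordRing (k : Type*) [Field k] (m n : ℕ) : Type _ :=
  MvPolynomial (Fin (m + 1) ⊕ Fin (n + 1)) k

/-- The bidegrees of the variables: `deg x_i = (1, 0)` and `deg y_j = (0, 1)`. -/
def bidegree (m n : ℕ) : Fin (m + 1) ⊕ Fin (n + 1) → ℕ × ℕ :=
  Sum.elim (fun _ => (1, 0)) (fun _ => (0, 1))

/-- `f` is a bihomogeneous form (of some bidegree). -/
def IsBiform {k : Type*} [Field k] {m n : ℕ} (f : BiCoordRing k m n) : Prop :=
  ∃ d : ℕ × ℕ, MvPolynomial.IsWeightedHomogeneous (bidegree m n) f d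

/-- `f` vanishes at the point `p = P × Q` of `ℙ^m × ℙ^n`, i.e. at every choice of homogeneous
coordinates of `P` and `Q` (for a bihomogeneous form one choice is as good as all). -/
def VanishesAt {k : Type*} [Field k] {m n : ℕ} (f : BiCoordRing k m n)
    (p : ProjSpace k m × ProjSpace k n) : Prop :=
  ∀ (a : Fin (m + 1) → k) (b : Fin (n + 1) → k) (ha : a ≠ 0) (hb : b ≠ 0),
    Projectivization.mk k a ha = p.1 → Projectivization.mk k b hb = p.2 →
      MvPolynomial.eval (Sum.elim a b) f = 0

/-- The ideal `I_X` of a set of points `X ⊆ ℙ^m × ℙ^n`: the ideal generated by all bihomogeneous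
forms that vanish at all the points of `X`. -/
noncomputable def pointsIdeal {k : Type*} [Field k] {m n : ℕ} (X : Set (ProjSpace k m × ProjSpace k n)) :
    Ideal (BiCoordRing k m n) :=
  Ideal.span {f | IsBiform f ∧ ∀ p ∈ X, VanishesAt f p}

/-- The homogeneous maximal ideal `(x_0, …, x_m, y_0, …, y_n)`. -/
noncomputable def homogeneousMaximalIdeal (k : Type*) [Field k] (m n : ℕ) : Ideal (BiCoordRing k m n) :=
  Ideal.span (Set.range MvPolynomial.X)

/-- The depth of the `A`-module `M` with respect to the ideal `J`: the supremum of the lengths of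
the `M`-regular sequences with entries in `J`. -/
noncomputable def depthIn {A : Type*} [CommRing A] (J : Ideal A) (M : Type*) [AddCommGroup M]
    [Module A M] : ℕ∞ :=
  ⨆ (rs : List A) (_ : RingTheory.Sequence.IsRegular M rs) (_ : ∀ r ∈ rs, r ∈ J),
    (rs.length : ℕ∞)

/-- A set of points `X ⊆ ℙ^m × ℙ^n` is arithmetically Cohen-Macaulay if
`dim R/I_X = depth R/I_X = 2`, where the depth of the graded ring `R/I_X` is taken with respect
to the homogeneous maximal ideal. -/
def IsACM {k : Type*} [Field k] {m n : ℕ} (X : Set (ProjSpace k m × ProjSpace k n)) : Prop :=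
  ringKrullDim (BiCoordRing k m n ⧸ pointsIdeal X) = 2 ∧
    depthIn (homogeneousMaximalIdeal k m n) (BiCoordRing k m n ⧸ pointsIdeal X) = 2

/-- The tuple `lam = (λ_1, …, λ_r)` of positive integers is a partition of `s`. -/
structure IsPartition {r : ℕ} (lam : Fin r → ℕ) (s : ℕ) : Prop where
  pos : ∀ i, 0 < lam i
  antitone : Antitone lam
  sum_eq : ∑ i, lam i = s

/-- The set of points `{P_i × Q_j : j ≤ λ_i}` (indices start at `0` here, so `j < λ_i`). -/
def ferrersPoints {k : Type*} [Field k] {m n r t : ℕ} (lam : Fin r → ℕ)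
    (P : Fin r → ProjSpace k m) (Q : Fin t → ProjSpace k n) :
    Set (ProjSpace k m × ProjSpace k n) :=
  {x | ∃ (i : Fin r) (j : Fin t), (j : ℕ) < lam i ∧ x = (P i, Q j)}

/-! ### Regular sequences and dimension of quotient rings. -/

section CommutativeAlgebra

open RingTheory.Sequence Ideal
open scoped Pointwise

/-! Choose linear forms `L = x₀ + α x₁` and `M = ψ(y)` vanishing at none of the points; then `L, M`
is a regular sequence on `R/I`. Since regular sequences are no longer than the dimension, it remains
to see `dim R/I ≤ 2`: a prime over `I` contains the ideal of a single point, whose residue ring is a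
quotient of a polynomial ring in two variables (`ringKrullDim_quotient_coneIdeal_le`).

`L` is regular because membership of a form in `I` is tested by values at the points. For `M`, scale
representatives so that `L = 1`: the points `P_i` become `(1, 0) + c_i (-α, 1)` with distinct `c_i`.
The crux is `mem_coneIdeal_sup_span_iff`: a form of bidegree `(d, e)` lies in `I + (L)` iff it
vanishes at `(-α, 1) × Q_j` for all `j` in row `d` (no condition if `d ≥ r`). This is again a test
by values, and multiplying by `M` does not change `d`. -/

lemma Module.supportDim_quot_add_length_le_of_isRegular {A : Type*} [CommRing A] {M : Type*}
    [AddCommGroup M] [Module A M] [Module.Finite A M] (rs : List A) (h : IsRegular M rs) :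
    (rs.length : WithBot ℕ∞) ≤ Module.supportDim A M := by
  induction rs generalizing M with
  | nil =>
    have := h.nontrivial
    obtain ⟨m, hm⟩ := WithBot.ne_bot_iff_exists.mp (Module.supportDim_ne_bot_of_nontrivial A M)
    rw [← hm]
    exact_mod_cast zero_le
  | cons x rs ih =>
    obtain ⟨hx, hrs⟩ := (isRegular_cons_iff M _ _).mp h
    calc ((x :: rs).length : WithBot ℕ∞) = rs.length + 1 := by simp
      _ ≤ Module.supportDim A (QuotSMulTop x M) + 1 := by gcongr; exact ih hrs
      _ ≤ _ := Module.supportDim_quotSMulTop_succ_le_of_notMem_minimalPrimes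
        fun _ => hx.notMem_of_mem_minimalPrimes

lemma depthIn_quotient_le_ringKrullDim {A : Type*} [CommRing A] (J I : Ideal A) {d : ℕ∞}
    (h : ringKrullDim (A ⧸ I) ≤ d) : depthIn J (A ⧸ I) ≤ d := by
  refine iSup_le fun rs => iSup_le fun hrs => iSup_le fun _ => ?_
  have := (Module.supportDim_quot_add_length_le_of_isRegular rs hrs).trans
    ((Module.supportDim_quotient_eq_ringKrullDim I).le.trans h)
  exact_mod_cast this

lemma length_le_ringKrullDim_quotient_of_isRegular {A : Type*} [CommRing A] (I : Ideal A)
    {rs : List A} (hrs : IsRegular (A ⧸ I) rs) :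
    (rs.length : WithBot ℕ∞) ≤ ringKrullDim (A ⧸ I) :=
  (Module.supportDim_quot_add_length_le_of_isRegular rs hrs).trans
    (Module.supportDim_quotient_eq_ringKrullDim I).le

/-- A chain of primes over `I` lies entirely over its smallest member. -/
lemma ringKrullDim_quotient_le_of_forall_prime {A : Type*} [CommRing A] (I : Ideal A)
    {d : WithBot ℕ∞} (h : ∀ p : Ideal A, p.IsPrime → I ≤ p → ringKrullDim (A ⧸ p) ≤ d) :
    ringKrullDim (A ⧸ I) ≤ d := by
  rw [ringKrullDim_quotient, Order.krullDim]
  refine iSup_le fun q => ?_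
  refine le_trans ?_ (h q.head.1.asIdeal q.head.1.isPrime q.head.2)
  rw [ringKrullDim_quotient, Order.krullDim]
  let q' : LTSeries (PrimeSpectrum.zeroLocus (R := A) q.head.1.asIdeal) :=
    { length := q.length
      toFun := fun i => ⟨(q i).1, q.monotone (Fin.zero_le i)⟩
      step := fun i => q.step i }
  exact le_iSup (fun p : LTSeries _ => (p.length : WithBot ℕ∞)) q'

lemma mk_mem_smul_top_iff {A : Type*} [CommRing A] (I : Ideal A) (a f : A) :
    Ideal.Quotient.mk I f ∈ (a • (⊤ : Submodule A (A ⧸ I))) ↔ f ∈ I ⊔ Ideal.span {a} := by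
  rw [Submodule.mem_smul_pointwise_iff_exists, Submodule.mem_sup]
  constructor
  · rintro ⟨b, -, hb⟩
    obtain ⟨g, rfl⟩ := Ideal.Quotient.mk_surjective b
    refine ⟨f - a * g, ?_, a * g, Ideal.mul_mem_right _ _ (Ideal.mem_span_singleton_self a), by ring⟩
    rw [← Ideal.Quotient.eq, ← hb, Algebra.smul_def, map_mul]
    rfl
  · rintro ⟨y, hy, z, hz, rfl⟩
    obtain ⟨g, rfl⟩ := Ideal.mem_span_singleton'.mp hz
    refine ⟨Ideal.Quotient.mk I g, trivial, ?_⟩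
    rw [map_add, Ideal.Quotient.eq_zero_iff_mem.mpr hy, zero_add, mul_comm, map_mul,
      Algebra.smul_def]
    rfl

lemma isRegular_pair_quotient {A : Type*} [CommRing A] (I J : Ideal A) (hJ : J ≠ ⊤) (hIJ : I ≤ J)
    {a b : A} (ha : a ∈ J) (hb : b ∈ J) (h₁ : ∀ f, a * f ∈ I → f ∈ I)
    (h₂ : ∀ f, b * f ∈ I ⊔ span {a} → f ∈ I ⊔ span {a}) :
    IsRegular (A ⧸ I) [a, b] := by
  refine ⟨?_, ?_⟩
  · rw [isWeaklyRegular_cons_iff, isWeaklyRegular_singleton_iff]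
    refine ⟨(isSMulRegular_quotient_iff_mem_of_smul_mem _ _).mpr fun f hf => h₁ f hf,
      (isSMulRegular_quotient_iff_mem_of_smul_mem _ _).mpr fun f hf => ?_⟩
    obtain ⟨f, rfl⟩ := Ideal.Quotient.mk_surjective f
    rw [mk_mem_smul_top_iff]
    refine h₂ f ((mk_mem_smul_top_iff I a _).mp ?_)
    rw [Algebra.smul_def] at hf
    rwa [map_mul]
  · intro h
    have hle : (Ideal.ofList [a, b] • ⊤ : Submodule A (A ⧸ I)) ≤ J • ⊤ := by
      refine Submodule.smul_mono_left ?_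
      simp [Ideal.span_le, ha, hb]
    have h1 : Ideal.Quotient.mk I 1 ∈ (J • ⊤ : Submodule A (A ⧸ I)) := hle (h ▸ trivial)
    have key : ∀ x ∈ (J • ⊤ : Submodule A (A ⧸ I)), ∃ y ∈ J, Ideal.Quotient.mk I y = x := by
      intro x hx
      refine Submodule.smul_induction_on hx ?_ ?_
      · intro r hr n _
        obtain ⟨n, rfl⟩ := Ideal.Quotient.mk_surjective n
        exact ⟨r * n, J.mul_mem_right _ hr, by rw [map_mul, Algebra.smul_def]; rfl⟩
      · rintro _ _ ⟨y, hy, rfl⟩ ⟨z, hz, rfl⟩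
        exact ⟨y + z, J.add_mem hy hz, map_add _ _ _⟩
    obtain ⟨y, hy, h2⟩ := key _ h1
    refine hJ ((Ideal.eq_top_iff_one J).mpr ?_)
    have := J.sub_mem hy (hIJ (Ideal.Quotient.eq.mp h2))
    simpa using this

end CommutativeAlgebra

/-! ### Weighted homogeneous polynomials. -/

namespace MvPolynomial

section Weighted

variable {σ R M : Type*} [CommRing R] [AddCommMonoid M] {w : σ → M}

lemma IsWeightedHomogeneous.aeval {τ M' : Type*} [AddCommMonoid M'] {w' : τ → M'} (δ : M →+ M')
    {f : MvPolynomial σ R} {d : M} (hf : IsWeightedHomogeneous w f d)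
    (g : σ → MvPolynomial τ R) (hg : ∀ i, IsWeightedHomogeneous w' (g i) (δ (w i))) :
    IsWeightedHomogeneous w' (MvPolynomial.aeval g f) (δ d) := by
  rw [aeval_def, eval₂_eq]
  refine IsWeightedHomogeneous.sum _ _ _ fun m hm => ?_
  refine IsWeightedHomogeneous.C_mul ?_ _
  have h := IsWeightedHomogeneous.prod m.support (fun i => g i ^ m i)
    (fun i => m i • δ (w i)) fun i _ => (hg i).pow _
  convert h using 1
  rw [← hf (mem_support_iff.mp hm), Finsupp.weight_apply, Finsupp.sum, map_sum]
  simp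

attribute [local instance] MvPolynomial.weightedGradedAlgebra

lemma weightedHomogeneousComponent_add_mul [DecidableEq M] [IsLeftCancelAdd M]
    {a : MvPolynomial σ R} {i : M} (ha : IsWeightedHomogeneous w a i) (b : MvPolynomial σ R)
    (j : M) : weightedHomogeneousComponent w (i + j) (a * b) =
      a * weightedHomogeneousComponent w j b := by
  let _ : AddLeftCancelMonoid M := { ‹AddCommMonoid M›, ‹IsLeftCancelAdd M› with }
  rw [← weightedDecomposition.decompose'_apply, ← weightedDecomposition.decompose'_apply]
  exact DirectSum.coe_decompose_mul_add_of_left_mem (weightedHomogeneousSubmodule R w) ha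

lemma isHomogeneous_span_of_isWeightedHomogeneous [DecidableEq M] (s : Set (MvPolynomial σ R))
    (hs : ∀ f ∈ s, ∃ d, IsWeightedHomogeneous w f d) :
    (Ideal.span s).IsHomogeneous (weightedHomogeneousSubmodule R w) :=
  Ideal.homogeneous_span _ _ hs

end Weighted
end MvPolynomial

/-! ### Ideals of points through chosen representatives, and the dimension bound. -/

section ConeIdeal

open MvPolynomial

variable {k : Type*} [Field k] {m n : ℕ}

lemma weight_bidegree (e : Fin (m + 1) ⊕ Fin (n + 1) →₀ ℕ) :
    Finsupp.weight (bidegree m n) e = (∑ i, e (Sum.inl i), ∑ j, e (Sum.inr j)) := by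
  rw [Finsupp.weight_apply, Finsupp.sum_fintype _ _ (by simp), Fintype.sum_sum_type]
  ext <;> simp [bidegree, Prod.fst_sum, Prod.snd_sum]

lemma aeval_smul_of_isWeightedHomogeneous {A : Type*} [CommRing A] [Algebra k A]
    {f : BiCoordRing k m n} {d : ℕ × ℕ} (hf : IsWeightedHomogeneous (bidegree m n) f d)
    (s t : A) (a : Fin (m + 1) → A) (b : Fin (n + 1) → A) :
    aeval (Sum.elim (fun i => s * a i) (fun j => t * b j)) f =
      s ^ d.1 * t ^ d.2 * aeval (Sum.elim a b) f := by
  rw [aeval_def, aeval_def, eval₂_eq', eval₂_eq', Finset.mul_sum]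
  refine Finset.sum_congr rfl fun e he => ?_
  have h := hf (mem_support_iff.mp he)
  rw [weight_bidegree] at h
  simp only [Fintype.prod_sum_type, Sum.elim_inl, Sum.elim_inr, mul_pow, Finset.prod_mul_distrib,
    Finset.prod_pow_eq_pow_sum, ← h]
  ring

lemma eval_smul_of_isWeightedHomogeneous
    {f : BiCoordRing k m n} {d : ℕ × ℕ} (hf : IsWeightedHomogeneous (bidegree m n) f d)
    (s t : k) (a : Fin (m + 1) → k) (b : Fin (n + 1) → k) :
    eval (Sum.elim (s • a) (t • b)) f = s ^ d.1 * t ^ d.2 * eval (Sum.elim a b) f := by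
  have := aeval_smul_of_isWeightedHomogeneous hf s t a b
  simpa only [aeval_eq_eval, RingHom.coe_coe] using! this

lemma vanishesAt_mk_iff {f : BiCoordRing k m n} (hf : IsBiform f) {a : Fin (m + 1) → k}
    {b : Fin (n + 1) → k} (ha : a ≠ 0) (hb : b ≠ 0) :
    VanishesAt f (Projectivization.mk k a ha, Projectivization.mk k b hb) ↔
      eval (Sum.elim a b) f = 0 := by
  refine ⟨fun h => h a b ha hb rfl rfl, fun h a' b' ha' hb' h₁ h₂ => ?_⟩
  obtain ⟨d, hd⟩ := hf
  obtain ⟨s, rfl⟩ := (Projectivization.mk_eq_mk_iff' k _ _ _ _).mp h₁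
  obtain ⟨t, rfl⟩ := (Projectivization.mk_eq_mk_iff' k _ _ _ _).mp h₂
  rw [eval_smul_of_isWeightedHomogeneous hd, h, mul_zero]

/-- The ideal generated by the bihomogeneous forms vanishing on a set of pairs of vectors. -/
noncomputable def coneIdeal (S : Set ((Fin (m + 1) → k) × (Fin (n + 1) → k))) :
    Ideal (BiCoordRing k m n) :=
  Ideal.span {f | IsBiform f ∧ ∀ q ∈ S, eval (Sum.elim q.1 q.2) f = 0}

lemma pointsIdeal_eq_coneIdeal {X : Set (ProjSpace k m × ProjSpace k n)}
    {S : Set ((Fin (m + 1) → k) × (Fin (n + 1) → k))}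
    (h : ∀ p, p ∈ X ↔ ∃ q ∈ S, ∃ (h₁ : q.1 ≠ 0) (h₂ : q.2 ≠ 0),
      p = (Projectivization.mk k q.1 h₁, Projectivization.mk k q.2 h₂))
    (hS : ∀ q ∈ S, q.1 ≠ 0 ∧ q.2 ≠ 0) : pointsIdeal X = coneIdeal S := by
  unfold pointsIdeal coneIdeal
  congr 1
  ext f
  refine and_congr_right fun hf => ⟨fun H q hq => ?_, fun H p hp => ?_⟩
  · exact (vanishesAt_mk_iff hf (hS q hq).1 (hS q hq).2).mp
      (H _ ((h _).mpr ⟨q, hq, (hS q hq).1, (hS q hq).2, rfl⟩))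
  · obtain ⟨q, hq, h₁, h₂, rfl⟩ := (h p).mp hp
    exact (vanishesAt_mk_iff hf h₁ h₂).mpr (H q hq)

variable {S : Set ((Fin (m + 1) → k) × (Fin (n + 1) → k))}

attribute [local instance] MvPolynomial.weightedGradedAlgebra

lemma isHomogeneous_coneIdeal :
    (coneIdeal S).IsHomogeneous (weightedHomogeneousSubmodule k (bidegree m n)) :=
  isHomogeneous_span_of_isWeightedHomogeneous _ fun _ hf => hf.1

lemma eval_eq_zero_of_mem_coneIdeal {f : BiCoordRing k m n} (hf : f ∈ coneIdeal S)
    {q : (Fin (m + 1) → k) × (Fin (n + 1) → k)} (hq : q ∈ S) :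
    eval (Sum.elim q.1 q.2) f = 0 := by
  have : coneIdeal S ≤ RingHom.ker (eval (Sum.elim q.1 q.2)) :=
    Ideal.span_le.mpr fun g hg => hg.2 q hq
  exact this hf

lemma mem_coneIdeal_iff_of_isBiform {f : BiCoordRing k m n} (hf : IsBiform f) :
    f ∈ coneIdeal S ↔ ∀ q ∈ S, eval (Sum.elim q.1 q.2) f = 0 :=
  ⟨fun h _ hq => eval_eq_zero_of_mem_coneIdeal h hq, fun h => Ideal.subset_span ⟨hf, h⟩⟩

/-- The ideal is bihomogeneous, so it suffices to cancel the nonzero value of `g` in each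
bihomogeneous component. -/
lemma mem_coneIdeal_of_mul_mem {f g : BiCoordRing k m n} (hg : IsBiform g)
    (hS : ∀ q ∈ S, eval (Sum.elim q.1 q.2) g ≠ 0) (h : g * f ∈ coneIdeal S) :
    f ∈ coneIdeal S := by
  obtain ⟨d, hd⟩ := hg
  rw [mem_iff_weightedHomogeneousComponent_mem _ _ isHomogeneous_coneIdeal] at h ⊢
  intro e
  have := h (d + e)
  rw [weightedHomogeneousComponent_add_mul hd] at this
  rw [mem_coneIdeal_iff_of_isBiform ⟨e, weightedHomogeneousComponent_isWeightedHomogeneous _ _⟩]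
  intro q hq
  have := eval_eq_zero_of_mem_coneIdeal this hq
  rw [map_mul] at this
  exact (mul_eq_zero.mp this).resolve_left (hS q hq)

lemma mem_homogeneousMaximalIdeal_iff {f : BiCoordRing k m n} :
    f ∈ homogeneousMaximalIdeal k m n ↔ coeff 0 f = 0 := by
  rw [homogeneousMaximalIdeal, ← Set.image_univ, mem_ideal_span_X_image]
  constructor
  · intro h
    by_contra h0
    obtain ⟨i, -, hi⟩ := h 0 (mem_support_iff.mpr h0)
    exact hi rfl
  · intro h e he
    by_contra! hc
    have : e = 0 := Finsupp.ext fun i => hc i trivial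
    exact mem_support_iff.mp he (this ▸ h)

lemma homogeneousMaximalIdeal_ne_top : homogeneousMaximalIdeal k m n ≠ ⊤ := by
  rw [Ne, Ideal.eq_top_iff_one, mem_homogeneousMaximalIdeal_iff]
  simp

lemma bidegree_ne_zero (i : Fin (m + 1) ⊕ Fin (n + 1)) : bidegree m n i ≠ 0 := by
  cases i <;> simp [bidegree]

lemma mem_homogeneousMaximalIdeal_of_ne_zero {f : BiCoordRing k m n} {d : ℕ × ℕ}
    (hf : IsWeightedHomogeneous (bidegree m n) f d) (hd : d ≠ 0) :
    f ∈ homogeneousMaximalIdeal k m n := by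
  rw [mem_homogeneousMaximalIdeal_iff]
  exact hf.coeff_eq_zero 0 (by simpa using hd.symm)

lemma coneIdeal_le_homogeneousMaximalIdeal (hS : S.Nonempty) :
    coneIdeal S ≤ homogeneousMaximalIdeal k m n := by
  refine Ideal.span_le.mpr ?_
  rintro f ⟨⟨d, hd⟩, hf⟩
  by_cases h0 : d = 0
  · subst h0
    obtain ⟨q, hq⟩ := hS
    have h := hd.weightedHomogeneousComponent_same
    rw [weightedHomogeneousComponent_zero f bidegree_ne_zero] at h
    have := hf q hq
    rw [← h, eval_C] at this
    exact mem_homogeneousMaximalIdeal_iff.mpr this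
  · exact mem_homogeneousMaximalIdeal_of_ne_zero hd h0

/-- The linear form in the `x_i` with the given coefficients. -/
noncomputable def xForm (n : ℕ) (φ : Fin (m + 1) → k) : BiCoordRing k m n :=
  ∑ i, C (φ i) * X (Sum.inl i)

/-- The linear form in the `y_j` with the given coefficients. -/
noncomputable def yForm (m : ℕ) (ψ : Fin (n + 1) → k) : BiCoordRing k m n :=
  ∑ j, C (ψ j) * X (Sum.inr j)

lemma isWeightedHomogeneous_xForm (φ : Fin (m + 1) → k) :
    IsWeightedHomogeneous (bidegree m n) (xForm n φ) (1, 0) :=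
  IsWeightedHomogeneous.sum _ _ _ fun i _ =>
    (isWeightedHomogeneous_X k (bidegree m n) (Sum.inl i)).C_mul _

lemma isWeightedHomogeneous_yForm (ψ : Fin (n + 1) → k) :
    IsWeightedHomogeneous (bidegree m n) (yForm m ψ) (0, 1) :=
  IsWeightedHomogeneous.sum _ _ _ fun j _ =>
    (isWeightedHomogeneous_X k (bidegree m n) (Sum.inr j)).C_mul _

lemma eval_xForm (φ : Fin (m + 1) → k) (a : Fin (m + 1) → k) (b : Fin (n + 1) → k) :
    eval (Sum.elim a b) (xForm n φ) = φ ⬝ᵥ a := by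
  simp [xForm, dotProduct]

lemma eval_yForm (ψ : Fin (n + 1) → k) (a : Fin (m + 1) → k) (b : Fin (n + 1) → k) :
    eval (Sum.elim a b) (yForm m ψ) = ψ ⬝ᵥ b := by
  simp [yForm, dotProduct]

/-- Otherwise each point has a form vanishing there but outside `p`; the product of these forms
vanishes on all of `S`, contradicting primality. -/
lemma exists_forall_mem_of_coneIdeal_le (hS : S.Finite) {p : Ideal (BiCoordRing k m n)}
    (hp : p.IsPrime) (hle : coneIdeal S ≤ p) :
    ∃ q ∈ S, ∀ f, IsBiform f → eval (Sum.elim q.1 q.2) f = 0 → f ∈ p := by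
  by_contra! hc
  choose! g hg₁ hg₂ hg₃ using hc
  have hprod : ∏ q ∈ hS.toFinset, g q ∈ p := by
    refine hle (Ideal.subset_span ⟨?_, fun q hq => ?_⟩)
    · choose! d hd using hg₁
      exact ⟨_, IsWeightedHomogeneous.prod _ _ d fun q hq => hd q (hS.mem_toFinset.mp hq)⟩
    · rw [map_prod]
      exact Finset.prod_eq_zero (hS.mem_toFinset.mpr hq) (hg₂ q hq)
  obtain ⟨q, hq, hq'⟩ := (hp.prod_mem_iff).mp hprod
  exact hg₃ q (hS.mem_toFinset.mp hq) hq'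

lemma ringKrullDim_quotient_coneIdeal_le (hS : S.Finite) (φ : Fin (m + 1) → k)
    (ψ : Fin (n + 1) → k) (hφ : ∀ q ∈ S, φ ⬝ᵥ q.1 = 1) (hψ : ∀ q ∈ S, ψ ⬝ᵥ q.2 = 1) :
    ringKrullDim (BiCoordRing k m n ⧸ coneIdeal S) ≤ 2 := by
  refine ringKrullDim_quotient_le_of_forall_prime _ fun p hp hle => ?_
  obtain ⟨q, hq, hmem⟩ := exists_forall_mem_of_coneIdeal_le hS hp hle
  -- Modulo `p`, each `x_i` equals `q.1 i` times `φ(x)` and each `y_j` equals `q.2 j` times `ψ(y)`,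
  -- as the differences are forms vanishing at `q`. Hence two elements generate the quotient.
  let F : MvPolynomial (Fin 2) k →ₐ[k] BiCoordRing k m n ⧸ p :=
    aeval ![Ideal.Quotient.mk p (xForm n φ), Ideal.Quotient.mk p (yForm m ψ)]
  let G : BiCoordRing k m n →ₐ[k] MvPolynomial (Fin 2) k :=
    aeval (Sum.elim (fun i => C (q.1 i) * X 0) (fun j => C (q.2 j) * X 1))
  have hFG : F.comp G = Ideal.Quotient.mkₐ k p := by
    refine algHom_ext fun i => ?_
    cases i with
    | inl i =>
      have h : F (G (X (Sum.inl i))) = Ideal.Quotient.mk p (C (q.1 i) * xForm n φ) := by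
        simp only [F, G, aeval_X, Sum.elim_inl, map_mul, algHom_C, Matrix.cons_val_zero]
        rfl
      refine h.trans (Ideal.Quotient.eq.mpr (hmem _ ⟨(1, 0), ?_⟩ ?_))
      · exact ((isWeightedHomogeneous_xForm φ).C_mul _).sub
          (isWeightedHomogeneous_X k (bidegree m n) (Sum.inl i))
      · simp [eval_xForm, hφ q hq]
    | inr j =>
      have h : F (G (X (Sum.inr j))) = Ideal.Quotient.mk p (C (q.2 j) * yForm m ψ) := by
        simp only [F, G, aeval_X, Sum.elim_inr, map_mul, algHom_C, Matrix.cons_val_one]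
        rfl
      refine h.trans (Ideal.Quotient.eq.mpr (hmem _ ⟨(0, 1), ?_⟩ ?_))
      · exact ((isWeightedHomogeneous_yForm ψ).C_mul _).sub
          (isWeightedHomogeneous_X k (bidegree m n) (Sum.inr j))
      · simp [eval_yForm, hψ q hq]
  have hsurj : Function.Surjective F := fun y => by
    obtain ⟨f, rfl⟩ := Ideal.Quotient.mk_surjective y
    exact ⟨G f, DFunLike.congr_fun hFG f⟩
  refine (ringKrullDim_le_of_surjective F.toRingHom hsurj).trans ?_
  simp

end ConeIdeal

/-! ### Ferrers configurations and their hyperplane section. -/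

section FerrersCone

open MvPolynomial

variable {k : Type*} [Field k] {m n : ℕ}

lemma natDegree_aeval_le_of_isWeightedHomogeneous {f : BiCoordRing k m n} {d : ℕ × ℕ}
    (hf : IsWeightedHomogeneous (bidegree m n) f d) (v u : Fin (m + 1) → k)
    (b : Fin (n + 1) → k) :
    (aeval (Sum.elim (fun i => Polynomial.C (v i) + Polynomial.C (u i) * Polynomial.X)
      (fun j => Polynomial.C (b j))) f).natDegree ≤ d.1 := by
  let θ : BiCoordRing k m n →ₐ[k] MvPolynomial (Fin (m + 1)) k :=
    aeval (Sum.elim X (fun j => C (b j)))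
  let ρ : MvPolynomial (Fin (m + 1)) k →ₐ[k] Polynomial k :=
    aeval (fun i => Polynomial.C (v i) + Polynomial.C (u i) * Polynomial.X)
  have hρθ : ρ.comp θ = aeval (Sum.elim
      (fun i => Polynomial.C (v i) + Polynomial.C (u i) * Polynomial.X)
      (fun j => Polynomial.C (b j))) := by
    refine algHom_ext fun i => ?_
    cases i <;> simp [ρ, θ, Polynomial.algebraMap_eq]
  have hθ : (θ f).IsHomogeneous d.1 := by
    refine hf.aeval (AddMonoidHom.fst ℕ ℕ) _ fun i => ?_
    cases i with
    | inl i => exact isWeightedHomogeneous_X k 1 i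
    | inr j => exact isWeightedHomogeneous_C 1 (b j)
  have h := aeval_natDegree_le (n := 1) (θ f) hθ.totalDegree_le
    (fun i => Polynomial.C (v i) + Polynomial.C (u i) * Polynomial.X) fun i => by
      compute_degree
  rw [mul_one] at h
  rw [← hρθ]
  exact h

lemma eval_aeval_polynomial (f : BiCoordRing k m n)
    (g : Fin (m + 1) ⊕ Fin (n + 1) → Polynomial k) (z : k) :
    (aeval g f).eval z = eval (fun i => (g i).eval z) f := by
  have h : (Polynomial.aeval z).comp (aeval g) = aeval (R := k) (fun i => (g i).eval z) := by
    refine algHom_ext fun i => ?_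
    simp
  have := DFunLike.congr_fun h f
  simpa [aeval_eq_eval] using this

/-- A form whose degree in the first variables is smaller than the number of its zeros on the
affine line `v + z u` vanishes at the point `u` at infinity of this line. -/
lemma eval_direction_eq_zero [Infinite k] {f : BiCoordRing k m n} {d : ℕ × ℕ}
    (hf : IsWeightedHomogeneous (bidegree m n) f d) (v u : Fin (m + 1) → k)
    (b : Fin (n + 1) → k) {c : Fin (d.1 + 1) → k} (hc : Function.Injective c)
    (h : ∀ i, eval (Sum.elim (v + c i • u) b) f = 0) : eval (Sum.elim u b) f = 0 := by
  have hline : ∀ z : k, eval (Sum.elim (v + z • u) b) f = 0 := by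
    let F := aeval (Sum.elim (fun i => Polynomial.C (v i) + Polynomial.C (u i) * Polynomial.X)
      (fun j => Polynomial.C (b j))) f
    have hF : ∀ z : k, F.eval z = eval (Sum.elim (v + z • u) b) f := by
      intro z
      rw [eval_aeval_polynomial]
      congr 2
      ext i
      cases i with
      | inl i => simp [mul_comm (u i)]
      | inr j => simp
    have hF0 : F = 0 := Polynomial.eq_zero_of_natDegree_lt_card_of_eval_eq_zero F hc
      (fun i => by rw [hF, h])
      (by simpa [Nat.lt_succ_iff] using natDegree_aeval_le_of_isWeightedHomogeneous hf v u b)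
    intro z
    rw [← hF, hF0, Polynomial.eval_zero]
  -- The reversed polynomial `z ^ d.1 * F(1/z)`: its value at `0` is the value of `f` at infinity.
  let H := aeval (Sum.elim (fun i => Polynomial.C (v i) * Polynomial.X + Polynomial.C (u i))
    (fun j => Polynomial.C (b j))) f
  have hH : ∀ z : k, H.eval z = eval (Sum.elim (z • v + u) b) f := by
    intro z
    rw [eval_aeval_polynomial]
    congr 2
    ext i
    cases i with
    | inl i => simp [mul_comm (v i)]
    | inr j => simp
  -- The rescaling needs `z ≠ 0`; the factor `X` takes care of `z = 0`.
  have hXH : Polynomial.X * H = 0 := by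
    refine Polynomial.funext fun z => ?_
    rw [Polynomial.eval_mul, Polynomial.eval_X, Polynomial.eval_zero, hH]
    by_cases hz : z = 0
    · rw [hz, zero_mul]
    · have e : Sum.elim (z • v + u) b = Sum.elim (z • (v + z⁻¹ • u)) ((1 : k) • b) := by
        rw [smul_add, smul_inv_smul₀ hz, one_smul]
      rw [e, eval_smul_of_isWeightedHomogeneous hf, hline, mul_zero, mul_zero]
  have h0 := hH 0
  rw [(mul_eq_zero.mp hXH).resolve_left Polynomial.X_ne_zero] at h0
  simpa using h0.symm

/-- The vectors `(1 - α c_i, c_i) × b_j` over the boxes `(i, j)` of a Ferrers diagram. -/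
def ferrersCone {r t : ℕ} (lam : Fin r → ℕ) (α : k) (c : ℕ → k)
    (b : Fin t → Fin (n + 1) → k) : Set ((Fin (1 + 1) → k) × (Fin (n + 1) → k)) :=
  {q | ∃ (i : Fin r) (j : Fin t), (j : ℕ) < lam i ∧ q = (![1, 0] + c i • ![-α, 1], b j)}

variable {r t : ℕ} {lam : Fin r → ℕ} {α : k} {c : ℕ → k} {b : Fin t → Fin (n + 1) → k}

attribute [local instance] MvPolynomial.weightedGradedAlgebra

lemma isHomogeneous_span_xForm (φ : Fin (m + 1) → k) :
    (Ideal.span {xForm n φ}).IsHomogeneous (weightedHomogeneousSubmodule k (bidegree m n)) :=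
  isHomogeneous_span_of_isWeightedHomogeneous _ fun f hf =>
    ⟨(1, 0), by rw [Set.mem_singleton_iff.mp hf]; exact isWeightedHomogeneous_xForm φ⟩

/-- Modulo the linear form `x₀ + α x₁`, a form is determined by its values at `(-α, 1)`. -/
lemma sub_mem_span_xForm {f : BiCoordRing k 1 n} {d : ℕ × ℕ}
    (hf : IsWeightedHomogeneous (bidegree 1 n) f d) :
    f - X (Sum.inl 1) ^ d.1 * aeval (Sum.elim (fun i => C ((![-α, 1] : Fin (1 + 1) → k) i))
      (fun j => X (Sum.inr j))) f ∈ Ideal.span {xForm n ![1, α]} := by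
  have h := aeval_smul_of_isWeightedHomogeneous hf (X (Sum.inl 1) : BiCoordRing k 1 n) 1
    (fun i => C ((![-α, 1] : Fin (1 + 1) → k) i)) (fun j => X (Sum.inr j))
  rw [one_pow, mul_one] at h
  rw [← h, ← Ideal.Quotient.eq]
  -- Modulo `x₀ + α x₁` one has `x₀ = -α x₁`, so this substitution becomes the identity.
  have key : (Ideal.Quotient.mkₐ k (Ideal.span {xForm n ![1, α]})).comp
      (aeval (Sum.elim (fun i => X (Sum.inl 1) * C ((![-α, 1] : Fin (1 + 1) → k) i))
        (fun j => 1 * X (Sum.inr j)))) = Ideal.Quotient.mkₐ k (Ideal.span {xForm n ![1, α]}) := by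
    refine algHom_ext fun i => ?_
    rw [AlgHom.comp_apply, aeval_X]
    refine Ideal.Quotient.eq.mpr ?_
    cases i with
    | inl i =>
      fin_cases i
      · refine Ideal.mem_span_singleton'.mpr ⟨-1, ?_⟩
        simp [xForm, Fin.sum_univ_two]
        ring
      · simp
    | inr j => simp
  exact (DFunLike.congr_fun key f).symm

lemma prod_sub_pow_mem_span {A : Type*} [CommRing A] (x a : A) (g : ℕ → A) (d : ℕ) :
    ∏ i ∈ Finset.range d, (x - g i * a) - x ^ d ∈ Ideal.span {a} := by
  rw [← Ideal.Quotient.eq, map_prod, map_pow]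
  have ha : Ideal.Quotient.mk (Ideal.span {a}) a = 0 :=
    Ideal.Quotient.eq_zero_iff_mem.mpr (Ideal.mem_span_singleton_self a)
  simp [ha]

/-- The hyperplane section of the cone: a form of bidegree `d` lies in the section of the ideal by
`x₀ + α x₁` if and only if it vanishes at `(-α, 1)` over the points of the row `d.1`. -/
lemma mem_coneIdeal_sup_span_iff [Infinite k] (hlam : Antitone lam)
    (hc : ∀ i < r, ∀ j < r, c i = c j → i = j) {f : BiCoordRing k 1 n} {d : ℕ × ℕ}
    (hf : IsWeightedHomogeneous (bidegree 1 n) f d) :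
    f ∈ coneIdeal (ferrersCone lam α c b) ⊔ Ideal.span {xForm n ![1, α]} ↔
      ∀ (i : Fin r) (j : Fin t), (i : ℕ) = d.1 → (j : ℕ) < lam i →
        eval (Sum.elim ![-α, 1] (b j)) f = 0 := by
  constructor
  · intro h i j hi hj
    obtain ⟨g, hg, l, hl, hgl⟩ := Submodule.mem_sup.mp h
    have hgl' := congrArg (weightedHomogeneousComponent (bidegree 1 n) d) hgl
    rw [map_add, hf.weightedHomogeneousComponent_same] at hgl'
    have hg' := weightedHomogeneousComponent_mem_of_mem k _ isHomogeneous_coneIdeal hg d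
    have hl' := weightedHomogeneousComponent_mem_of_mem k _ (isHomogeneous_span_xForm _) hl d
    have hlker : Ideal.span {xForm n ![1, α]} ≤
        RingHom.ker (eval (Sum.elim ![-α, 1] (b j))) := by
      rw [Ideal.span_singleton_le_iff_mem, RingHom.mem_ker, eval_xForm]
      simp [dotProduct, Fin.sum_univ_two]
    have hl'' := hlker hl'
    rw [RingHom.mem_ker] at hl''
    rw [← hgl', map_add, hl'', add_zero]
    -- Rows `0, …, d.1` all reach column `j`, giving `d.1 + 1` zeros on the line, one more than the
    -- degree allows.
    refine eval_direction_eq_zero (weightedHomogeneousComponent_isWeightedHomogeneous d g)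
      ![1, 0] ![-α, 1] (b j) (c := fun i => c i) ?_ fun i' => ?_
    · intro x y hxy
      exact Fin.ext (hc x (by omega) y (by omega) hxy)
    · have hi' : (i' : ℕ) < r := by omega
      exact eval_eq_zero_of_mem_coneIdeal (q := (_, b j)) hg'
        ⟨⟨i', hi'⟩, j, hj.trans_le (hlam (by rw [Fin.le_def]; dsimp only; omega)), rfl⟩
  · intro h
    set g : BiCoordRing k 1 n := aeval (Sum.elim (fun i => C ((![-α, 1] : Fin (1 + 1) → k) i))
      (fun j => X (Sum.inr j))) f with hg
    have hgw : IsWeightedHomogeneous (bidegree 1 n) g (0, d.2) := by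
      refine hf.aeval ((AddMonoidHom.inr ℕ ℕ).comp (AddMonoidHom.snd ℕ ℕ)) _ fun i => ?_
      cases i with
      | inl i => exact isWeightedHomogeneous_C _ _
      | inr j => exact isWeightedHomogeneous_X k (bidegree 1 n) (Sum.inr j)
    have hge : ∀ a b, eval (Sum.elim a b) g = eval (Sum.elim ![-α, 1] b) f := by
      intro a b
      have e : (aeval (R := k) (Sum.elim a b)).comp
          (aeval (Sum.elim (fun i => C ((![-α, 1] : Fin (1 + 1) → k) i))
            (fun j => (X (Sum.inr j) : BiCoordRing k 1 n)))) = aeval (Sum.elim ![-α, 1] b) := by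
        refine algHom_ext fun i => ?_
        cases i <;> simp
      have := DFunLike.congr_fun e f
      simpa only [aeval_eq_eval, RingHom.coe_coe] using! this
    let p : BiCoordRing k 1 n :=
      -- The factor for `i` vanishes on row `i`, where `L = 1` and `x₁ = c i`. Modulo `L` the
      -- product is `x₁ ^ d.1`, so `p * g` is congruent to `f`.
      ∏ i ∈ Finset.range d.1, (X (Sum.inl 1) - C (c i) * xForm n ![1, α])
    have hpw : IsBiform (p * g) := by
      refine ⟨_, (IsWeightedHomogeneous.prod _ _ (fun _ => (1, 0)) fun i _ => ?_).mul hgw⟩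
      exact (isWeightedHomogeneous_X k (bidegree 1 n) (Sum.inl 1)).sub
        ((isWeightedHomogeneous_xForm _).C_mul _)
    have hpg : p * g ∈ coneIdeal (ferrersCone lam α c b) := by
      rw [mem_coneIdeal_iff_of_isBiform hpw]
      rintro _ ⟨i, j, hj, rfl⟩
      rw [map_mul]
      by_cases hi : (i : ℕ) < d.1
      · refine mul_eq_zero_of_left ?_ _
        rw [map_prod]
        refine Finset.prod_eq_zero (Finset.mem_range.mpr hi) ?_
        rw [map_sub, map_mul, eval_xForm]
        simp [dotProduct, Fin.sum_univ_two]
        ring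
      -- Rows from `d.1` on are no longer than row `d.1`, so `g` vanishes over their columns.
      · refine mul_eq_zero_of_right _ ?_
        rw [hge]
        have hd : d.1 < r := by omega
        exact h ⟨d.1, hd⟩ j rfl (hj.trans_le (hlam (by rw [Fin.le_def]; dsimp only; omega)))
    have h₁ := sub_mem_span_xForm (α := α) hf
    have h₂ := Ideal.mul_mem_right g _
      (prod_sub_pow_mem_span (X (Sum.inl 1)) (xForm n ![1, α]) (fun i => C (c i)) d.1)
    refine Submodule.mem_sup.mpr ⟨_, hpg, _, Ideal.sub_mem _ h₁ h₂, ?_⟩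
    simp only [p, ← hg]
    ring

/-- The form in `y` has bidegree `(0, 1)`, so a component and its multiple are tested on the same
row, where the extra factor is nonzero. -/
lemma mem_coneIdeal_sup_span_of_mul_mem [Infinite k] (hlam : Antitone lam)
    (hc : ∀ i < r, ∀ j < r, c i = c j → i = j) {ψ : Fin (n + 1) → k}
    (hψ : ∀ j, ψ ⬝ᵥ b j ≠ 0) {f : BiCoordRing k 1 n}
    (h : yForm 1 ψ * f ∈ coneIdeal (ferrersCone lam α c b) ⊔ Ideal.span {xForm n ![1, α]}) :
    f ∈ coneIdeal (ferrersCone lam α c b) ⊔ Ideal.span {xForm n ![1, α]} := by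
  have hhom := isHomogeneous_coneIdeal (S := ferrersCone lam α c b) |>.sup
    (isHomogeneous_span_xForm ![1, α])
  rw [mem_iff_weightedHomogeneousComponent_mem _ _ hhom] at h ⊢
  intro d
  have hd := h ((0, 1) + d)
  have hw := weightedHomogeneousComponent_isWeightedHomogeneous (w := bidegree 1 n) d f
  rw [weightedHomogeneousComponent_add_mul (isWeightedHomogeneous_yForm ψ),
    mem_coneIdeal_sup_span_iff hlam hc ((isWeightedHomogeneous_yForm ψ).mul hw)] at hd
  rw [mem_coneIdeal_sup_span_iff hlam hc hw]
  intro i j hi hj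
  have := hd i j (by simpa using hi) hj
  rw [map_mul, eval_yForm] at this
  exact (mul_eq_zero.mp this).resolve_left (hψ j)

end FerrersCone

/-! ### Choice of general linear forms, and the theorem. -/

lemma exists_forall_dotProduct_ne_zero {ι k : Type*} [Field k] [Infinite k] [Finite ι] {n : ℕ}
    (v : ι → Fin n → k) (hv : ∀ i, v i ≠ 0) : ∃ ψ : Fin n → k, ∀ i, ψ ⬝ᵥ v i ≠ 0 := by
  obtain ⟨φ, hφ⟩ := Module.exists_dual_forall_apply_ne_zero (K := k) v hv
  refine ⟨fun i => φ (Pi.single i 1), fun i => ?_⟩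
  convert hφ i using 1
  conv_rhs => rw [LinearMap.pi_apply_eq_sum_univ φ (v i)]
  refine Finset.sum_congr rfl fun j _ => ?_
  rw [mul_comm, smul_eq_mul]
  refine congrArg (fun w => v i j * φ w) (funext fun l => ?_)
  simp [Pi.single_apply, eq_comm]

lemma exists_forall_add_mul_ne_zero {ι k : Type*} [Field k] [Infinite k] [Finite ι]
    (v : ι → Fin 2 → k) (hv : ∀ i, v i ≠ 0) : ∃ α : k, ∀ i, v i 0 + α * v i 1 ≠ 0 := by
  -- When `v i 1 = 0` every `α` works; division by zero then merely excludes `0` needlessly.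
  obtain ⟨α, hα⟩ := (Set.finite_range fun i => -v i 0 / v i 1).infinite_compl.nonempty
  refine ⟨α, fun i h => ?_⟩
  by_cases h1 : v i 1 = 0
  · refine hv i (funext fun j => ?_)
    fin_cases j
    · simpa [h1] using h
    · exact h1
  · refine hα ⟨i, ?_⟩
    dsimp only
    rw [div_eq_iff h1]
    linear_combination -h

theorem theorem4p12 {k : Type*} [Field k] [IsAlgClosed k] [CharZero k]
    {n r s : ℕ} (hr : 0 < r) (lam : Fin r → ℕ) (hlam : IsPartition lam s)
    (P : Fin r → ProjSpace k 1) (hP : Function.Injective P)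
    (Q : Fin (lam ⟨0, hr⟩) → ProjSpace k n) (hQ : Function.Injective Q) :
    IsACM (ferrersPoints lam P Q) := by
  obtain ⟨α, hα⟩ := exists_forall_add_mul_ne_zero (fun i => (P i).rep) fun i => (P i).rep_nonzero
  obtain ⟨ψ, hψ⟩ := exists_forall_dotProduct_ne_zero (fun j => (Q j).rep)
    fun j => (Q j).rep_nonzero
  -- The `x₁`-coordinate of `P i` after scaling to `L = 1`. Indices beyond `r` occur only in
  -- products for large `d.1`, where any value serves.
  let c : ℕ → k := fun i =>
    if h : i < r then (P ⟨i, h⟩).rep 1 / ((P ⟨i, h⟩).rep 0 + α * (P ⟨i, h⟩).rep 1) else 0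
  let a : Fin r → Fin (1 + 1) → k := fun i => ![1, 0] + c i • ![-α, 1]
  let b : Fin (lam ⟨0, hr⟩) → Fin (n + 1) → k := fun j => (ψ ⬝ᵥ (Q j).rep)⁻¹ • (Q j).rep
  have ha : ∀ i, a i = ((P i).rep 0 + α * (P i).rep 1)⁻¹ • (P i).rep := by
    intro i
    have hci : c i = (P i).rep 1 / ((P i).rep 0 + α * (P i).rep 1) := by simp [c]
    have hi := hα i
    ext l
    fin_cases l
    · have : 1 + c i * -α = ((P i).rep 0 + α * (P i).rep 1)⁻¹ * (P i).rep 0 := by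
        rw [hci, eq_inv_mul_iff_mul_eq₀ hi, mul_add, ← mul_assoc, mul_div_cancel₀ _ hi]
        ring
      simpa [a] using this
    · simp [a, hci, div_eq_inv_mul]
  have hψb : ∀ j, ψ ⬝ᵥ b j = 1 := fun j => by
    rw [dotProduct_smul, smul_eq_mul, inv_mul_cancel₀ (hψ j)]
  have ha0 : ∀ i, a i ≠ 0 := fun i => by
    rw [ha]
    exact smul_ne_zero (inv_ne_zero (hα i)) (P i).rep_nonzero
  have hb0 : ∀ j, b j ≠ 0 := fun j => smul_ne_zero (inv_ne_zero (hψ j)) (Q j).rep_nonzero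
  have hPa : ∀ i, Projectivization.mk k (a i) (ha0 i) = P i := fun i => by
    conv_rhs => rw [← (P i).mk_rep]
    exact (Projectivization.mk_eq_mk_iff' k _ _ _ _).mpr ⟨_, (ha i).symm⟩
  have hQb : ∀ j, Projectivization.mk k (b j) (hb0 j) = Q j := fun j => by
    conv_rhs => rw [← (Q j).mk_rep]
    exact (Projectivization.mk_eq_mk_iff' k _ _ _ _).mpr ⟨_, rfl⟩
  have hc : ∀ i < r, ∀ j < r, c i = c j → i = j := by
    intro i hi j hj hij
    have haa : a ⟨i, hi⟩ = a ⟨j, hj⟩ := by simp only [a, hij]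
    have : P ⟨i, hi⟩ = P ⟨j, hj⟩ := by
      rw [← hPa, ← hPa ⟨j, hj⟩]
      congr 1
    exact congrArg Fin.val (hP this)
  have hX : pointsIdeal (ferrersPoints lam P Q) = coneIdeal (ferrersCone lam α c b) := by
    refine pointsIdeal_eq_coneIdeal (fun p => ⟨?_, ?_⟩) ?_
    · rintro ⟨i, j, hj, rfl⟩
      exact ⟨(a i, b j), ⟨i, j, hj, rfl⟩, ha0 i, hb0 j, Prod.ext (hPa i).symm (hQb j).symm⟩
    · rintro ⟨_, ⟨i, j, hj, rfl⟩, h₁, h₂, rfl⟩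
      exact ⟨i, j, hj, Prod.ext (hPa i) (hQb j)⟩
    · rintro _ ⟨i, j, hj, rfl⟩
      exact ⟨ha0 i, hb0 j⟩
  have hfin : (ferrersCone lam α c b).Finite := by
    refine (Set.finite_range fun x : Fin r × Fin (lam ⟨0, hr⟩) => (a x.1, b x.2)).subset ?_
    rintro _ ⟨i, j, -, rfl⟩
    exact ⟨(i, j), rfl⟩
  have hne : (ferrersCone lam α c b).Nonempty :=
    ⟨_, ⟨0, hr⟩, ⟨0, hlam.pos _⟩, hlam.pos _, rfl⟩
  have hL : ∀ q ∈ ferrersCone lam α c b, (![1, α] : Fin (1 + 1) → k) ⬝ᵥ q.1 = 1 := by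
    rintro _ ⟨i, j, -, rfl⟩
    simp [dotProduct, Fin.sum_univ_two]
    ring
  have hdim := ringKrullDim_quotient_coneIdeal_le hfin ![1, α] ψ hL
    (by rintro _ ⟨i, j, -, rfl⟩; exact hψb j)
  have hLmem : xForm n ![1, α] ∈ homogeneousMaximalIdeal k 1 n :=
    mem_homogeneousMaximalIdeal_of_ne_zero (isWeightedHomogeneous_xForm _) (by simp)
  have hMmem : yForm 1 ψ ∈ homogeneousMaximalIdeal k 1 n :=
    mem_homogeneousMaximalIdeal_of_ne_zero (isWeightedHomogeneous_yForm _) (by simp)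
  have hreg : RingTheory.Sequence.IsRegular (BiCoordRing k 1 n ⧸ coneIdeal (ferrersCone lam α c b))
      [xForm n ![1, α], yForm 1 ψ] := by
    refine isRegular_pair_quotient _ _ homogeneousMaximalIdeal_ne_top
      (coneIdeal_le_homogeneousMaximalIdeal hne) hLmem hMmem (fun f hf => ?_) fun f hf => ?_
    · refine mem_coneIdeal_of_mul_mem ⟨_, isWeightedHomogeneous_xForm _⟩ (fun q hq => ?_) hf
      rw [eval_xForm, hL q hq]
      exact one_ne_zero
    · exact mem_coneIdeal_sup_span_of_mul_mem hlam.antitone hc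
        (fun j => by rw [hψb]; exact one_ne_zero) hf
  unfold IsACM
  rw [hX]
  refine ⟨le_antisymm hdim (length_le_ringKrullDim_quotient_of_isRegular _ hreg),
    le_antisymm (depthIn_quotient_le_ringKrullDim _ _ (d := 2) hdim) ?_⟩
  exact le_iSup_of_le _ (le_iSup_of_le hreg (le_iSup_of_le (by simp [hLmem, hMmem]) le_rfl))
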